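/- Let $r\ge 1$, $\delta\ge 2$, $n$, $k$ be integers and write $n=w(r+\delta-1)+m$ with $0\le m<r+\delta-1$, and $k=ur+v$ with $0<v\le r$, where $w,m,u,v$ are nonnegative integers. For a linear code $\mathcal C\subseteq\mathbb F_q^n$, an $(r,\delta)$-repair set is a set $S\subseteq\{1,\dots,n\}$ with $|S|\le r+\delta-1$ such that for every $l\in S$ and every $L\subseteq S\setminus\{l\}$ with $|L|=\max\{|S|-(\delta-1),0\}$ the symbol $c_l$ is a linear function of $(c_i)_{i\in L}$, for $\mathbf c\in\mathcal C$ (so if $|S|\le\delta-1$, all codewords vanish on $S$). The code has $(r,\delta)_a$-locality if every coordinate lies in at least one $(r,\delta)$-repair set. Let $d_{\max}$ be the largest $d$ such that, for some prime power $q$, there exists a linear code over $\mathbb F_q$ of length $n$, dimension $k$ and minimum Hamming distance $d$ with $(r,\delta)_a$-locality. Assume $m>0$ and $v<r$ (that is, $r+\delta-1\nmid n$ and $r\nmid k$), $0<r<k\le n-\lceil k/r\rceil(\delta-1)$ and $v>\max\{m-\delta+1,\lfloor r/2\rfloor\}$. Then $d_{\max}$ exists in each of the following two cases, and $$d_{\max}=n-k+1-\left\lceil\frac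 kr\right\rceil(\delta-1)+\begin{cases}0,&\text{if } m\ge\delta\text{ and }u\ge\max\{2(r+\delta-1-m),\,r+\delta-1\},\\ \delta-1-m,&\text{if } m\le\delta-1\text{ and }u\ge 2r+\delta-1.\end{cases}$$ -/

import Mathlib

namespace LRC

/-- `S` is an `(r, δ)`-repair set of the linear code `C` of length `n`: `|S| ≤ r + δ - 1`, and each
symbol `c_l`, `l ∈ S`, is a linear function of the symbols in any `L ⊆ S \ {l}` with
`|L| = |S| - (δ - 1)`. The subtraction is truncated: if `|S| ≤ δ - 1`, then `L = ∅` and the condition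
says that all the codewords vanish on `S`, so that in every case the condition means that any `δ - 1`
erasures within `S` can be recovered from the rest of `S`. -/
def IsRepairSet {F : Type*} [Field F] {n : ℕ} (C : Submodule F (Fin n → F)) (r δ : ℕ)
    (S : Finset (Fin n)) : Prop :=
  S.card ≤ r + δ - 1 ∧
    ∀ l ∈ S, ∀ L ⊆ S.erase l, L.card = S.card - (δ - 1) →
      ∃ a : Fin n → F, ∀ c ∈ C, c l = ∑ i ∈ L, a i * c i

/-- All-symbol `(r, δ)`-locality: every coordinate lies in some `(r, δ)`-repair set. -/
def HasLocality {F : Type*} [Field F] {n : ℕ} (C : Submodule F (Fin n → F)) (r δ : ℕ) : Prop :=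
  ∀ i : Fin n, ∃ S : Finset (Fin n), i ∈ S ∧ IsRepairSet C r δ S

/-- `d` is the minimum Hamming distance of `C`. -/
def IsMinDist {F : Type*} [Field F] [DecidableEq F] {n : ℕ} (C : Submodule F (Fin n → F))
    (d : ℕ) : Prop :=
  IsLeast {t : ℕ | ∃ x ∈ C, ∃ y ∈ C, x ≠ y ∧ hammingDist x y = t} d

/-- The set of all `d` for which, over some finite field, there is a linear `[n, k, d]` code with
all-symbol `(r, δ)`-locality (as integers). -/
def distances (n k r δ : ℕ) : Set ℤ :=
  {z : ℤ | ∃ (F : Type) (_ : Field F) (_ : Fintype F) (_ : DecidableEq F)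
    (C : Submodule F (Fin n → F)) (d : ℕ),
      Module.finrank F C = k ∧ HasLocality C r δ ∧ IsMinDist C d ∧ z = (d : ℤ)}

/-- `z` is `d_max`: the largest `d` such that a linear `[n, k, d]` code with all-symbol
`(r, δ)`-locality exists over some finite field. -/
def IsDMax (n k r δ : ℕ) (z : ℤ) : Prop :=
  IsGreatest (distances n k r δ) z

end LRC

/-! Put `ε = δ - 1`. Both cases assert `d_max = n + 1 - (k + u ε + min m ε)`.

Upper bound. View coordinates as functionals `x i` spanning the dual of the code, a space of
dimension `k`. A proper subspace `W` is annihilated by a nonzero codeword, so `d ≤ n - |flat x W|`.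
Call `|flat x W| - dim W` the nullity of `W`. Adjoining a repair set not contained in `W` raises the
rank by at most `r` and the nullity by at least `ε`. If `d` were too large, greedy enlargement to a
hyperplane would therefore bound the nullity of every small subspace. Under these bounds the members
of an irredundant cover by repair sets behave almost generically: none lies in the span of at most
`u` others (`not_spanOn_le_supSpan`), and any large total excess or overlap already shows in a small
subfamily. Hence `n` is close to a multiple of `r + ε` (`exists_card_near_multiple`), which the
residue `m` excludes.

Construction. Split the coordinates into `w` blocks of length `r + ε` and one of length `m`, take
local Vandermonde vectors over `ZMod p`, embed them in an extension field and evaluate linearized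
polynomials there (`exists_code_hasLocality`). A nonzero codeword vanishes only on points of rank
below `k`, and any `k + u ε + min m ε` points have rank at least `k`. -/

namespace LRC

set_option linter.unusedSectionVars false

open Finset Module Submodule

/-! ### Flats of a vector configuration and enlargement by repair sets. -/

section Flats

variable {F V ι : Type*} [Field F] [AddCommGroup V] [Module F V]

/-- The span of the vectors `x i` with `i ∈ S`. -/
def spanOn (F : Type*) {V ι : Type*} [Field F] [AddCommGroup V] [Module F V] (x : ι → V)
    (S : Finset ι) : Submodule F V :=
  span F (Set.image x S)

/-- The vector form of a repair set with at most `N` elements that recovers `ε` erasures. -/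
def IsVecRepair (F : Type*) {V ι : Type*} [Field F] [AddCommGroup V] [Module F V] (x : ι → V)
    (N ε : ℕ) (S : Finset ι) : Prop :=
  S.card ≤ N ∧ ∀ L ⊆ S, L.card = S.card - ε → spanOn F x S ≤ spanOn F x L

lemma mem_spanOn {x : ι → V} {S : Finset ι} {i : ι} (h : i ∈ S) : x i ∈ spanOn F x S :=
  subset_span ⟨i, h, rfl⟩

lemma spanOn_le {x : ι → V} {S : Finset ι} {W : Submodule F V} :
    spanOn F x S ≤ W ↔ ∀ i ∈ S, x i ∈ W := by
  simp [spanOn, span_le, Set.subset_def]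

lemma finrank_spanOn_le (x : ι → V) (S : Finset ι) : finrank F (spanOn F x S) ≤ S.card := by
  classical
  have := finrank_span_finset_le_card (R := F) (S.image x)
  rw [coe_image] at this
  exact this.trans card_image_le

lemma exists_notMem_of_finrank_lt {x : ι → V} (hx : span F (Set.range x) = ⊤)
    {W : Submodule F V} (hW : finrank F W < finrank F V) : ∃ j, x j ∉ W := by
  by_contra hall
  push Not at hall
  have : (⊤ : Submodule F V) ≤ W := by
    rw [← hx, span_le]; rintro _ ⟨j, rfl⟩; exact hall j
  rw [top_le_iff.1 this, finrank_top] at hW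
  omega

variable [Fintype ι]

open Classical in
/-- The indices of the vectors that lie in the subspace `W`. -/
noncomputable def flat (x : ι → V) (W : Submodule F V) : Finset ι :=
  univ.filter fun i => x i ∈ W

@[simp] lemma mem_flat {x : ι → V} {W : Submodule F V} {i : ι} : i ∈ flat x W ↔ x i ∈ W := by
  simp [flat]

lemma flat_mono {x : ι → V} {W W' : Submodule F V} (h : W ≤ W') : flat x W ⊆ flat x W' :=
  fun i hi => by simpa using h (by simpa using hi)

variable [DecidableEq ι]

lemma card_flat_add_le_card_flat_sup (x : ι → V) (S : Finset ι) (W : Submodule F V) :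
    (flat x W).card + (S \ flat x W).card ≤ (flat x (W ⊔ spanOn F x S)).card := by
  rw [← card_union_of_disjoint disjoint_sdiff]
  refine card_le_card (union_subset (flat_mono le_sup_left) fun i hi => ?_)
  rw [mem_flat]
  exact mem_sup_right (mem_spanOn (mem_sdiff.1 hi).1)

variable [FiniteDimensional F V]

/-- Any `ε` elements of `S` can be discarded without shrinking its span. Fewer than `ε` elements
outside `W` would put all of `S` in `W`; otherwise `ε` of the outside elements are superfluous, so
the nullity grows by at least `ε`. -/
lemma IsVecRepair.finrank_sup_add_le {x : ι → V} {N ε : ℕ} {S : Finset ι}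
    (hS : IsVecRepair F x N ε S) {W : Submodule F V} (hW : ¬ spanOn F x S ≤ W) :
    finrank F ↥(W ⊔ spanOn F x S) + ε ≤ finrank F W + (S \ flat x W).card := by
  have hε : ε ≤ (S \ flat x W).card := by
    by_contra hlt
    push Not at hlt
    have h1 : (S ∩ flat x W).card + (S \ flat x W).card = S.card := card_inter_add_card_sdiff _ _
    obtain ⟨L, hL, hLc⟩ := exists_subset_card_eq (s := S ∩ flat x W) (n := S.card - ε) (by omega)
    refine hW ((hS.2 L (hL.trans inter_subset_left) hLc).trans (spanOn_le.2 fun i hi => ?_))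
    have := hL hi
    simp at this
    exact this.2
  obtain ⟨D, hD, hDc⟩ := exists_subset_card_eq hε
  have hDS : D ⊆ S := hD.trans sdiff_subset
  have hL := hS.2 (S \ D) sdiff_subset (by rw [card_sdiff_of_subset hDS, hDc])
  have hle : W ⊔ spanOn F x S ≤ W ⊔ spanOn F x ((S \ flat x W) \ D) := by
    refine sup_le le_sup_left (hL.trans (spanOn_le.2 fun i hi => ?_))
    by_cases hiW : x i ∈ W
    · exact mem_sup_left hiW
    · refine mem_sup_right (mem_spanOn ?_)
      simp only [mem_sdiff, mem_flat] at hi ⊢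
      exact ⟨⟨hi.1, hiW⟩, hi.2⟩
  have h1 := Submodule.finrank_mono hle
  have h2 := Submodule.finrank_add_le_finrank_add_finrank W (spanOn F x ((S \ flat x W) \ D))
  have h3 := finrank_spanOn_le (F := F) x ((S \ flat x W) \ D)
  rw [card_sdiff_of_subset hD, hDc] at h3
  omega

lemma IsVecRepair.finrank_sup_le {x : ι → V} {r ε : ℕ} {S : Finset ι}
    (hS : IsVecRepair F x (r + ε) ε S) (W : Submodule F V) :
    finrank F ↥(W ⊔ spanOn F x S) ≤ finrank F W + r := by
  by_cases hW : spanOn F x S ≤ W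
  · rw [sup_eq_left.2 hW]; omega
  · have h1 := hS.finrank_sup_add_le hW
    have h2 : (S \ flat x W).card ≤ S.card := card_le_card sdiff_subset
    have := hS.1
    omega

/-- If the repair sets cover all indices, then a proper subspace can be enlarged `i` times, each time
by a repair set that it does not contain. -/
lemma exists_enlarge {x : ι → V} {r ε : ℕ} (hx : span F (Set.range x) = ⊤)
    (hcov : ∀ i, ∃ S, i ∈ S ∧ IsVecRepair F x (r + ε) ε S) (i : ℕ) :
    ∀ W : Submodule F V, finrank F W + i * r < finrank F V →
      ∃ W' : Submodule F V, finrank F W' ≤ finrank F W + i * r ∧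
        (flat x W).card + finrank F W' + i * ε ≤ (flat x W').card + finrank F W := by
  induction i with
  | zero => intro W _; exact ⟨W, by omega, by omega⟩
  | succ i ih =>
    intro W hW
    obtain ⟨j, hj⟩ := exists_notMem_of_finrank_lt hx (W := W) (by omega)
    obtain ⟨S, hjS, hS⟩ := hcov j
    have hSW : ¬ spanOn F x S ≤ W := fun h => hj (h (mem_spanOn hjS))
    have h1 := hS.finrank_sup_add_le hSW
    have h2 := card_flat_add_le_card_flat_sup (F := F) x S W
    have h3 := hS.finrank_sup_le W
    rw [add_mul, one_mul] at hW
    obtain ⟨W', h4, h5⟩ := ih (W ⊔ spanOn F x S) (by omega)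
    refine ⟨W', ?_, ?_⟩
    · rw [add_mul, one_mul]; omega
    · rw [add_mul, one_mul]; omega

/-- Enlarging a subspace by single vectors up to codimension one. -/
lemma exists_finrank_add_one_eq {x : ι → V} (hx : span F (Set.range x) = ⊤) (i : ℕ) :
    ∀ W : Submodule F V, finrank F W + i + 1 = finrank F V →
      ∃ W' : Submodule F V, finrank F W' + 1 = finrank F V ∧
        (flat x W).card + i ≤ (flat x W').card := by
  induction i with
  | zero => intro W h; exact ⟨W, by omega, by omega⟩
  | succ i ih =>
    intro W hW
    obtain ⟨j, hj⟩ := exists_notMem_of_finrank_lt hx (W := W) (by omega)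
    have h2 := card_flat_add_le_card_flat_sup (F := F) x {j} W
    have hj' : ({j} : Finset ι) \ flat x W = {j} := by
      rw [Finset.sdiff_eq_self_iff_disjoint]; simpa using hj
    rw [hj', card_singleton] at h2
    have h3 : finrank F ↥(W ⊔ spanOn F x {j}) ≤ finrank F W + 1 := by
      have h := Submodule.finrank_add_le_finrank_add_finrank W (spanOn F x {j})
      have h' := finrank_spanOn_le (F := F) x {j}
      rw [card_singleton] at h'
      omega
    have h4 : finrank F W < finrank F ↥(W ⊔ spanOn F x {j}) := by
      refine Submodule.finrank_lt_finrank_of_lt (lt_of_le_of_ne le_sup_left fun h => hj ?_)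
      rw [h]
      exact mem_sup_right (mem_spanOn (by simp))
    obtain ⟨W', h5, h6⟩ := ih (W ⊔ spanOn F x {j}) (by omega)
    exact ⟨W', h5, by omega⟩

end Flats

/-! ### Families of repair sets and irredundant covers. -/

section Families

variable {F V ι : Type*} [Field F] [AddCommGroup V] [Module F V] [Fintype ι] [DecidableEq ι]

/-- The indices of the vectors that lie in one of the subspaces spanned by the members of `I`. -/
noncomputable def covered (F : Type*) {V ι : Type*} [Field F] [AddCommGroup V] [Module F V]
    [Fintype ι] [DecidableEq ι] (x : ι → V) (I : Finset (Finset ι)) : Finset ι :=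
  I.biUnion fun S => flat x (spanOn F x S)

/-- The span of all vectors with an index in a member of `I`. -/
def supSpan (F : Type*) {V ι : Type*} [Field F] [AddCommGroup V] [Module F V]
    (x : ι → V) (I : Finset (Finset ι)) : Submodule F V :=
  I.sup (spanOn F x)

lemma mem_covered {x : ι → V} {I : Finset (Finset ι)} {i : ι} :
    i ∈ covered F x I ↔ ∃ S ∈ I, x i ∈ spanOn F x S := by
  simp [covered]

lemma covered_mono {x : ι → V} {I J : Finset (Finset ι)} (h : I ⊆ J) :
    covered F x I ⊆ covered F x J :=
  biUnion_subset_biUnion_of_subset_left _ h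

lemma card_covered_insert (x : ι → V) (I : Finset (Finset ι)) (S : Finset ι) :
    (covered F x (insert S I)).card =
      (covered F x I).card + (flat x (spanOn F x S) \ covered F x I).card := by
  rw [covered, biUnion_insert, union_comm, ← union_sdiff_self_eq_union,
    card_union_of_disjoint disjoint_sdiff]
  rfl

@[simp] lemma finrank_supSpan_empty (x : ι → V) : finrank F (supSpan F x ∅) = 0 := by
  rw [supSpan, sup_empty, finrank_bot]

lemma supSpan_insert (x : ι → V) (I : Finset (Finset ι)) (S : Finset ι) :
    supSpan F x (insert S I) = supSpan F x I ⊔ spanOn F x S := by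
  rw [supSpan, sup_insert, sup_comm]; rfl

lemma covered_subset_flat (x : ι → V) (I : Finset (Finset ι)) :
    covered F x I ⊆ flat x (supSpan F x I) := by
  intro i hi
  obtain ⟨S, hS, hi⟩ := mem_covered.1 hi
  exact mem_flat.2 (Finset.le_sup (f := spanOn F x) hS hi)

lemma subset_flat_spanOn (x : ι → V) (S : Finset ι) : S ⊆ flat x (spanOn F x S) :=
  fun _ hi => mem_flat.2 (mem_spanOn hi)

variable [FiniteDimensional F V]

lemma finrank_supSpan_union_le {x : ι → V} {r ε : ℕ} {I J : Finset (Finset ι)}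
    (hJ : ∀ S ∈ J, IsVecRepair F x (r + ε) ε S) :
    finrank F (supSpan F x (I ∪ J)) ≤ finrank F (supSpan F x I) + (J \ I).card * r := by
  rw [← union_sdiff_self_eq_union]
  have hK : ∀ S ∈ J \ I, IsVecRepair F x (r + ε) ε S := fun S hS => hJ S (mem_sdiff.1 hS).1
  generalize J \ I = K at hK
  induction K using Finset.induction_on with
  | empty => rw [union_empty]; simp
  | insert S K hSK ih =>
    rw [union_insert, supSpan_insert, card_insert_of_notMem hSK, add_mul, one_mul]
    have h1 := (hK S (mem_insert_self _ _)).finrank_sup_le (supSpan F x (I ∪ K))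
    have h2 := ih fun T hT => hK T (mem_insert_of_mem hT)
    omega

lemma finrank_supSpan_le {x : ι → V} {r ε : ℕ} {J : Finset (Finset ι)}
    (hJ : ∀ S ∈ J, IsVecRepair F x (r + ε) ε S) :
    finrank F (supSpan F x J) ≤ J.card * r := by
  have := finrank_supSpan_union_le (I := ∅) hJ
  rwa [empty_union, sdiff_empty, finrank_supSpan_empty, zero_add] at this

/-- If no member of the family `A` is contained in the span of at most `t` others, then the union of
`t + 1` members has nullity at least `(t + 1) * ε`. -/
lemma finrank_add_le_card_covered {x : ι → V} {N ε t : ℕ} {A : Finset (Finset ι)}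
    (hA : ∀ S ∈ A, IsVecRepair F x N ε S)
    (hind : ∀ I ⊆ A, I.card ≤ t → ∀ S ∈ A, S ∉ I → ¬ spanOn F x S ≤ supSpan F x I)
    {I : Finset (Finset ι)} (hI : I ⊆ A) (ht : I.card ≤ t + 1) :
    finrank F (supSpan F x I) + I.card * ε ≤ (covered F x I).card := by
  induction I using Finset.induction_on with
  | empty => simp
  | insert S I hSI ih =>
    rw [card_insert_of_notMem hSI] at ht ⊢
    have hSA := hI (mem_insert_self _ _)
    have hIA : I ⊆ A := (subset_insert _ _).trans hI
    have h1 := ih hIA (by omega)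
    have h2 := (hA S hSA).finrank_sup_add_le (hind I hIA (by omega) S hSA hSI)
    have h3 : (S \ flat x (supSpan F x I)).card ≤
        (flat x (spanOn F x S) \ covered F x I).card :=
      card_le_card (sdiff_subset_sdiff (subset_flat_spanOn x S) (covered_subset_flat x I))
    rw [supSpan_insert, card_covered_insert, add_mul, one_mul]
    omega

/-- A cover by spans of repair sets, none of which is redundant. -/
lemma exists_antichain_cover [Nontrivial V] {x : ι → V} {N ε : ℕ}
    (hx : span F (Set.range x) = ⊤)
    (hcov : ∀ i, ∃ S, i ∈ S ∧ IsVecRepair F x N ε S) :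
    ∃ A : Finset (Finset ι), (∀ S ∈ A, IsVecRepair F x N ε S) ∧
      (∀ S ∈ A, ¬ spanOn F x S ≤ ⊥) ∧
      (∀ S ∈ A, ∀ T ∈ A, S ≠ T → ¬ spanOn F x S ≤ spanOn F x T) ∧
      covered F x A = univ := by
  classical
  -- A cover of minimal cardinality is an antichain: a member whose span lies in another's could be
  -- dropped.
  let P : Finset (Finset (Finset ι)) := univ.filter fun A =>
    (∀ S ∈ A, IsVecRepair F x N ε S ∧ ¬ spanOn F x S ≤ ⊥) ∧ covered F x A = univ
  have hP : P.Nonempty := by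
    refine ⟨univ.filter fun S => IsVecRepair F x N ε S ∧ ¬ spanOn F x S ≤ ⊥, ?_⟩
    have key : ∀ i, x i ≠ 0 → ∃ S, i ∈ S ∧ IsVecRepair F x N ε S ∧ ¬ spanOn F x S ≤ ⊥ := by
      intro i hi
      obtain ⟨S, hiS, hS⟩ := hcov i
      exact ⟨S, hiS, hS, fun h => hi (by simpa using h (mem_spanOn hiS))⟩
    simp only [P, mem_filter, mem_univ, true_and, eq_univ_iff_forall]
    refine ⟨fun S h => h, fun i => ?_⟩
    rw [mem_covered]
    by_cases hi : x i = 0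
    -- A zero vector lies in every span, so any member with nonzero span covers it.
    · obtain ⟨j, hj⟩ := exists_notMem_of_finrank_lt hx (W := ⊥)
        (by rw [finrank_bot]; exact finrank_pos)
      obtain ⟨S, -, hS⟩ := key j (by simpa using hj)
      exact ⟨S, by simpa using hS, by rw [hi]; exact zero_mem _⟩
    · obtain ⟨S, hiS, hS⟩ := key i hi
      exact ⟨S, by simpa using hS, mem_spanOn hiS⟩
  obtain ⟨A, hAP, hmin⟩ := exists_min_image P card hP
  simp only [P, mem_filter, mem_univ, true_and] at hAP
  refine ⟨A, fun S hS => (hAP.1 S hS).1, fun S hS => (hAP.1 S hS).2, ?_, hAP.2⟩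
  intro S hS T hT hne hle
  have hmem : A.erase S ∈ P := by
    simp only [P, mem_filter, mem_univ, true_and]
    refine ⟨fun R hR => hAP.1 R (mem_of_mem_erase hR), ?_⟩
    rw [eq_univ_iff_forall]
    intro i
    have hi : i ∈ covered F x A := by rw [hAP.2]; exact mem_univ i
    obtain ⟨R, hR, hiR⟩ := mem_covered.1 hi
    rw [mem_covered]
    by_cases hRS : R = S
    · exact ⟨T, mem_erase.2 ⟨hne.symm, hT⟩, hle (hRS ▸ hiR)⟩
    · exact ⟨R, mem_erase.2 ⟨hRS, hR⟩, hiR⟩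
  have := hmin _ hmem
  have := card_erase_lt_of_mem hS
  omega

end Families

/-! ### Near-genericity of the cover under nullity bounds. -/

section Counting

variable {F V ι : Type*} [Field F] [AddCommGroup V] [Module F V] [Fintype ι] [DecidableEq ι]
  [FiniteDimensional F V] {x : ι → V} {r ε s μ u : ℕ} {A : Finset (Finset ι)}

/-- In an antichain of repair sets, none is contained in the span of at most `u` others. -/
lemma not_spanOn_le_supSpan (hs : 2 * s ≤ r + 1) (hμ : μ ≤ ε)
    (hnull : ∀ (W : Submodule F V) (j : ℕ), j ≤ u → finrank F W ≤ j * r →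
      (flat x W).card < finrank F W + j * ε + μ)
    (hrank : ∀ (W : Submodule F V) (j : ℕ), j ≤ u + 1 → finrank F W + s ≤ j * r →
      (flat x W).card < finrank F W + j * ε)
    (hA : ∀ S ∈ A, IsVecRepair F x (r + ε) ε S)
    (hbot : ∀ S ∈ A, ¬ spanOn F x S ≤ ⊥)
    (hanti : ∀ S ∈ A, ∀ T ∈ A, S ≠ T → ¬ spanOn F x S ≤ spanOn F x T) (c : ℕ) :
    ∀ I ⊆ A, I.card ≤ c → c ≤ u → ∀ S ∈ A, S ∉ I → ¬ spanOn F x S ≤ supSpan F x I := by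
  induction c with
  | zero =>
    intro I _ hc _ S hS _
    rw [card_eq_zero.1 (Nat.le_zero.1 hc)]
    exact hbot S hS
  | succ c ih =>
    intro I hI hIc hcu S hS hSI hle
    have hind : ∀ J ⊆ A, J.card ≤ c → ∀ T ∈ A, T ∉ J → ¬ spanOn F x T ≤ supSpan F x J :=
      fun J hJ hJc => ih J hJ hJc (by omega)
    by_cases hI0 : I.card ≤ c
    · exact hind I hI hI0 S hS hSI hle
    obtain ⟨T, hT⟩ := card_pos.1 (show 0 < I.card by omega)
    have hcard : (I.erase T).card + 1 = I.card := card_erase_add_one hT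
    by_cases hc0 : c = 0
    · obtain ⟨T', rfl⟩ := card_eq_one.1 (show I.card = 1 by omega)
      rw [supSpan, sup_singleton] at hle
      exact hanti S hS T' (hI (by simp)) (by simpa using hSI) hle
    -- `B` together with `S` has nullity at least `(|B| + 1) ε`, so `hrank` forces its rank above
    -- `(|B| + 1) r - s`. As `B` has rank at most `|B| r`, adjoining `S` gains at least `r - s + 1`
    -- in rank.
    have key : ∀ B ⊆ I, B.card ≤ c → r + ε + 1 ≤ (S \ flat x (supSpan F x B)).card + s := by
      intro B hBI hBc
      have hSB : S ∉ B := fun h => hSI (hBI h)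
      have hBA := hBI.trans hI
      have h1 := (hA S hS).finrank_sup_add_le (hind B hBA hBc S hS hSB)
      have h2 := finrank_supSpan_le fun R hR => hA R (hBA hR)
      have h3 := finrank_add_le_card_covered hA hind (I := insert S B)
        (insert_subset hS hBA) (by rw [card_insert_of_notMem hSB]; omega)
      have h4 := card_le_card (covered_subset_flat (F := F) x (insert S B))
      have h5 := hrank (supSpan F x (insert S B)) (insert S B).card
        (by rw [card_insert_of_notMem hSB]; omega)
      have h6 : (insert S B).card * r < finrank F (supSpan F x (insert S B)) + s := by
        by_contra h
        have := h5 (by omega)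
        omega
      rw [supSpan_insert, card_insert_of_notMem hSB, add_mul, one_mul] at h6
      omega
    have k1 := key {T} (by simpa using hT) (by simp; omega)
    have k2 := key (I.erase T) (erase_subset _ _) (by omega)
    have k3 := (hA S hS).1
    -- Two large parts of `S` must overlap. Since `2 * s ≤ r + 1`, more than `ε` elements of `S` are
    -- not covered by `I`; they lie in its span, and this extra nullity contradicts `hnull`.
    have h1 : (S \ flat x (supSpan F x {T})).card + (S \ flat x (supSpan F x (I.erase T))).card
        ≤ S.card + (S \ covered F x I).card := by
      rw [← card_union_add_card_inter]
      refine add_le_add (card_le_card (union_subset sdiff_subset sdiff_subset))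
        (card_le_card fun i hi => ?_)
      simp only [mem_inter, mem_sdiff] at hi ⊢
      refine ⟨hi.1.1, fun hiI => ?_⟩
      obtain ⟨R, hR, hiR⟩ := mem_covered.1 hiI
      by_cases hRT : R = T
      · exact hi.1.2 (covered_subset_flat x _ (mem_covered.2 ⟨R, by simpa using hRT, hiR⟩))
      · exact hi.2.2 (covered_subset_flat x _
          (mem_covered.2 ⟨R, mem_erase.2 ⟨hRT, hR⟩, hiR⟩))
    have h2 : (covered F x I).card + (S \ covered F x I).card ≤
        (flat x (supSpan F x I)).card := by
      rw [← card_union_of_disjoint disjoint_sdiff]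
      refine card_le_card (union_subset (covered_subset_flat x I) ?_)
      exact sdiff_subset.trans ((subset_flat_spanOn x S).trans (flat_mono hle))
    have h3 := finrank_add_le_card_covered hA hind hI (by omega)
    have h4 := hnull (supSpan F x I) I.card (by omega)
      (finrank_supSpan_le fun R hR => hA R (hI hR))
    omega

/-- A family whose union exceeds the expected size by `t` has a subfamily of at most `t` members
with the same property. -/
lemma exists_small_subfamily_large (N : ℕ) (I : Finset (Finset ι)) :
    ∀ t : ℕ, I.card * N + t ≤ (covered F x I).card →
      ∃ J ⊆ I, J.card ≤ t ∧ J.card * N + t ≤ (covered F x J).card := by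
  induction I using Finset.induction_on with
  | empty =>
    intro t ht
    exact ⟨∅, Subset.rfl, by simp, ht⟩
  | insert S I hSI ih =>
    intro t ht
    rcases Nat.eq_zero_or_pos t with rfl | htpos
    · exact ⟨∅, empty_subset _, by simp, by simp⟩
    rw [card_insert_of_notMem hSI, card_covered_insert, add_mul, one_mul] at ht
    -- Members gaining at most `N` are dropped. Each one kept lowers the remaining target by at
    -- least one, and its gain only grows over a subfamily.
    by_cases hgain : (flat x (spanOn F x S) \ covered F x I).card ≤ N
    · obtain ⟨J, hJ, h1, h2⟩ := ih t (by omega)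
      exact ⟨J, hJ.trans (subset_insert _ _), h1, h2⟩
    · obtain ⟨J, hJ, h1, h2⟩ : ∃ J ⊆ I,
          J.card ≤ t - ((flat x (spanOn F x S) \ covered F x I).card - N) ∧
          J.card * N + (t - ((flat x (spanOn F x S) \ covered F x I).card - N)) ≤
            (covered F x J).card := by
        by_cases ht' : t ≤ (flat x (spanOn F x S) \ covered F x I).card - N
        · exact ⟨∅, empty_subset _, by simp, by simp; omega⟩
        · exact ih _ (by omega)
      refine ⟨insert S J, insert_subset_insert _ hJ, ?_, ?_⟩
      · rw [card_insert_of_notMem fun h => hSI (hJ h)]; omega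
      · rw [card_insert_of_notMem fun h => hSI (hJ h), card_covered_insert, add_mul, one_mul]
        have : (flat x (spanOn F x S) \ covered F x I).card ≤
            (flat x (spanOn F x S) \ covered F x J).card :=
          card_le_card (sdiff_subset_sdiff Subset.rfl (covered_mono hJ))
        omega

/-- Every set of covered indices is covered by as many members of the family. -/
lemma exists_subfamily_covered {I : Finset (Finset ι)}
    {G : Finset ι} (hG : G ⊆ covered F x I) : ∃ J ⊆ I, J.card ≤ G.card ∧ G ⊆ covered F x J := by
  choose! f hf hxf using fun i (hi : i ∈ G) => mem_covered.1 (hG hi)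
  exact ⟨G.image f, image_subset_iff.2 hf, card_image_le,
    fun i hi => mem_covered.2 ⟨f i, mem_image_of_mem f hi, hxf i hi⟩⟩

/-- A family whose union misses the expected size by `t` has a subfamily of at most `2 * t` members
whose rank misses the expected rank by `t`. -/
lemma exists_small_subfamily_low_rank {T : ℕ} (hA : ∀ S ∈ A, IsVecRepair F x (r + ε) ε S)
    (hind : ∀ I ⊆ A, I.card + 1 ≤ 2 * T → ∀ S ∈ A, S ∉ I →
      ¬ spanOn F x S ≤ supSpan F x I) {I : Finset (Finset ι)} (hI : I ⊆ A) :
    ∀ t ≤ T, (covered F x I).card + t ≤ I.card * (r + ε) →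
      ∃ J ⊆ I, J.card ≤ 2 * t ∧ finrank F (supSpan F x J) + t ≤ J.card * r := by
  induction I using Finset.induction_on with
  | empty =>
    intro t _ h
    rw [card_empty, zero_mul] at h
    exact ⟨∅, Subset.rfl, by simp, by rw [finrank_supSpan_empty]; omega⟩
  | insert S I hSI ih =>
    intro t htT ht
    have hSA := hI (mem_insert_self _ _)
    have hIA : I ⊆ A := (subset_insert _ _).trans hI
    rcases Nat.eq_zero_or_pos t with rfl | htpos
    · exact ⟨∅, empty_subset _, by simp, by simp⟩
    rw [card_insert_of_notMem hSI, card_covered_insert, add_mul, one_mul] at ht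
    by_cases hgain : r + ε ≤ (flat x (spanOn F x S) \ covered F x I).card
    · obtain ⟨J, hJ, h1, h2⟩ := ih hIA t htT (by omega)
      exact ⟨J, hJ.trans (subset_insert _ _), h1, h2⟩
    push Not at hgain
    -- `b` is the part of the deficit charged to `S`, capped at `t`; `J` accounts for the remaining
    -- `t'`.
    obtain ⟨b, t', hb, hb', hbt, J, hJ, h1, h2⟩ : ∃ b t' : ℕ, 1 ≤ b ∧
        b + (flat x (spanOn F x S) \ covered F x I).card ≤ r + ε ∧ t' + b = t ∧ ∃ J ⊆ I,
          J.card ≤ 2 * t' ∧ finrank F (supSpan F x J) + t' ≤ J.card * r := by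
      by_cases ht' : t + (flat x (spanOn F x S) \ covered F x I).card ≤ r + ε
      · exact ⟨t, 0, htpos, ht', by omega, ∅, empty_subset _, by simp, by simp⟩
      · refine ⟨r + ε - (flat x (spanOn F x S) \ covered F x I).card,
          t - (r + ε - (flat x (spanOn F x S) \ covered F x I).card), by omega, by omega,
          by omega, ih hIA _ (by omega) (by omega)⟩
    have hScard := (hA S hSA).1
    have hmono : (S \ covered F x I).card ≤ (flat x (spanOn F x S) \ covered F x I).card :=
      card_le_card (sdiff_subset_sdiff (subset_flat_spanOn x S) Subset.rfl)
    have hsplit : (S ∩ covered F x I).card + (S \ covered F x I).card = S.card :=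
      card_inter_add_card_sdiff _ _
    -- A deficit `b` not explained by `S` being short comes from overlap. At most `b` members `K`
    -- witness it, so `S` adds rank at most `r - b` to `J ∪ K`. The size is at most `2 * t' + b + 1
    -- ≤ 2 * t`, as `b ≥ 1`.
    obtain ⟨G, hG, hGc⟩ := exists_subset_card_eq (s := S ∩ covered F x I)
      (n := b - (r + ε - S.card)) (by omega)
    obtain ⟨K, hK, hKc, hGK⟩ := exists_subfamily_covered (hG.trans inter_subset_right)
    have hJK : J ∪ K ⊆ I := union_subset hJ hK
    have hSJK : S ∉ J ∪ K := fun h => hSI (hJK h)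
    have hcardJK : (J ∪ K).card = J.card + (K \ J).card := by
      rw [← union_sdiff_self_eq_union, card_union_of_disjoint disjoint_sdiff]
    have hKJ : (K \ J).card ≤ K.card := card_le_card sdiff_subset
    refine ⟨insert S (J ∪ K), insert_subset_insert _ hJK, ?_, ?_⟩
    · rw [card_insert_of_notMem hSJK]; omega
    · have h3 := (hA S hSA).finrank_sup_add_le
        (hind (J ∪ K) (hJK.trans hIA) (by omega) S hSA hSJK)
      have h4 := finrank_supSpan_union_le (I := J) fun R hR => hA R (hIA (hK hR))
      have h5 : (S \ flat x (supSpan F x (J ∪ K))).card ≤ (S \ G).card :=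
        card_le_card (sdiff_subset_sdiff Subset.rfl
          (hGK.trans ((covered_mono subset_union_right).trans (covered_subset_flat x _))))
      rw [card_sdiff_of_subset (hG.trans inter_subset_left)] at h5
      rw [card_insert_of_notMem hSJK, supSpan_insert, hcardJK, add_mul, add_mul, one_mul]
      omega

/-- If all subspaces satisfy the counting bound of a code with too large a distance, then the length
is close to a multiple of `r + ε`. -/
theorem exists_card_near_multiple [Nontrivial V] (hx : span F (Set.range x) = ⊤)
    (hcov : ∀ i, ∃ S, i ∈ S ∧ IsVecRepair F x (r + ε) ε S)
    (hs : 2 * s ≤ r + 1) (hμ : μ ≤ ε) (hru : r ≤ u) (hεu : ε ≤ u)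
    (hnull : ∀ (W : Submodule F V) (j : ℕ), j ≤ u → finrank F W ≤ j * r →
      (flat x W).card < finrank F W + j * ε + μ)
    (hrank : ∀ (W : Submodule F V) (j : ℕ), j ≤ u + 1 → finrank F W + s ≤ j * r →
      (flat x W).card < finrank F W + j * ε) :
    ∃ p : ℕ, Fintype.card ι < p * (r + ε) + μ ∧ p * (r + ε) < Fintype.card ι + s := by
  obtain ⟨A, hA, hbot, hanti, hcover⟩ := exists_antichain_cover hx hcov
  have hind : ∀ I ⊆ A, I.card ≤ u → ∀ S ∈ A, S ∉ I → ¬ spanOn F x S ≤ supSpan F x I :=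
    fun I hI hIu => not_spanOn_le_supSpan hs hμ hnull hrank hA hbot hanti u I hI hIu le_rfl
  refine ⟨A.card, ?_, ?_⟩
  · by_contra h
    push Not at h
    rw [← card_univ, ← hcover] at h
    obtain ⟨J, hJ, h1, h2⟩ := exists_small_subfamily_large (r + ε) A μ h
    have h3 := finrank_supSpan_le fun S hS => hA S (hJ hS)
    have h4 := hnull (supSpan F x J) J.card (by omega) h3
    have h5 := card_le_card (covered_subset_flat (F := F) x J)
    rw [mul_add] at h2
    omega
  · by_contra h
    push Not at h
    rw [← card_univ, ← hcover] at h
    obtain ⟨J, hJ, h1, h2⟩ := exists_small_subfamily_low_rank (T := s) hA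
      (fun I hI hIc => hind I hI (by omega)) Subset.rfl s le_rfl h
    have h3 := finrank_add_le_card_covered hA hind hJ (by omega)
    have h4 := hrank (supSpan F x J) J.card (by omega) h2
    have h5 := card_le_card (covered_subset_flat (F := F) x J)
    omega

end Counting

/-! ### The upper bound on the distance. -/

section UpperBound

variable {F : Type*} [Field F] {n : ℕ}

/-- The `i`-th coordinate as a linear functional on the code. -/
def coordFun (C : Submodule F (Fin n → F)) (i : Fin n) : Dual F C :=
  (LinearMap.proj i : (Fin n → F) →ₗ[F] F) ∘ₗ C.subtype

@[simp] lemma coordFun_apply (C : Submodule F (Fin n → F)) (i : Fin n) (c : C) :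
    coordFun C i c = (c : Fin n → F) i := rfl

lemma span_range_coordFun (C : Submodule F (Fin n → F)) :
    span F (Set.range (coordFun C)) = ⊤ := by
  refine span_eq_top_of_ne_zero fun c hc => ?_
  by_contra h
  push Not at h
  refine hc (Subtype.ext (funext fun i => ?_))
  simpa using h _ ⟨i, rfl⟩

lemma IsRepairSet.isVecRepair {C : Submodule F (Fin n → F)} {r ε : ℕ} {S : Finset (Fin n)}
    (hS : IsRepairSet C r (ε + 1) S) : IsVecRepair F (coordFun C) (r + ε) ε S := by
  refine ⟨hS.1, fun L hL hLc => spanOn_le.2 fun l hl => ?_⟩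
  by_cases hlL : l ∈ L
  · exact mem_spanOn hlL
  obtain ⟨a, ha⟩ := hS.2 l hl L (fun i hi => mem_erase.2 ⟨fun h => hlL (h ▸ hi), hL hi⟩) hLc
  have : coordFun C l = ∑ i ∈ L, a i • coordFun C i := by
    ext c
    simpa using ha c c.2
  rw [this]
  exact sum_mem fun i hi => smul_mem _ _ (mem_spanOn hi)

lemma IsMinDist.add_card_flat_le [DecidableEq F] {C : Submodule F (Fin n → F)} {d : ℕ}
    (hd : IsMinDist C d) {W : Submodule F (Dual F C)} (hW : finrank F W < finrank F C) :
    d + (flat (coordFun C) W).card ≤ n := by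
  have h1 := Subspace.finrank_add_finrank_dualCoannihilator_eq W
  have h2 : W.dualCoannihilator ≠ ⊥ := by
    intro h
    rw [h, finrank_bot] at h1
    omega
  obtain ⟨c, hc, hc0⟩ := exists_mem_ne_zero_of_ne_bot h2
  have h3 : d ≤ hammingDist (c : Fin n → F) 0 :=
    hd.2 ⟨c, c.2, 0, zero_mem _, by simpa using hc0, rfl⟩
  have h4 : hammingDist (c : Fin n → F) 0 ≤ (flat (coordFun C) W)ᶜ.card := by
    refine card_le_card fun i hi => ?_
    simp only [mem_filter, mem_univ, true_and, Pi.zero_apply] at hi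
    rw [mem_compl, mem_flat]
    intro hiW
    exact hi ((mem_dualCoannihilator c).1 hc _ hiW)
  rw [card_compl, Fintype.card_fin] at h4
  have := card_le_univ (flat (coordFun C) W)
  rw [Fintype.card_fin] at this
  omega

/-- The distance bound for codes whose length is not close to a multiple of `r + ε` from below. -/
theorem IsMinDist.le_of_hasLocality [DecidableEq F] {C : Submodule F (Fin n → F)}
    {d r ε μ u v w m : ℕ} (hd : IsMinDist C d) (hC : HasLocality C r (ε + 1))
    (hk : finrank F C = u * r + v) (hv : 0 < v) (hvr : r < 2 * v) (hvr' : v ≤ r)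
    (hru : r ≤ u) (hεu : ε ≤ u) (hn : n = w * (r + ε) + m) (hμ : μ ≤ ε) (hμm : μ ≤ m)
    (hm : m < v + ε) :
    d + (u * r + v) + u * ε + μ ≤ n + 1 := by
  by_contra hlt
  push Not at hlt
  have hdual : finrank F (Dual F C) = u * r + v := by rw [Subspace.dual_finrank_eq, hk]
  have : Nontrivial (Dual F C) := nontrivial_of_finrank_pos (R := F) (by omega)
  have hx := span_range_coordFun C
  have hcov : ∀ i, ∃ S, i ∈ S ∧ IsVecRepair F (coordFun C) (r + ε) ε S := fun i => by
    obtain ⟨S, hi, hS⟩ := hC i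
    exact ⟨S, hi, hS.isVecRepair⟩
  -- Enlarge `W` by `i` repair sets, then by single vectors up to a hyperplane, which contains at
  -- most `n - d` of the functionals.
  have hcount : ∀ (W : Submodule F (Dual F C)) (i : ℕ), finrank F W + i * r < u * r + v →
      (flat (coordFun C) W).card + i * ε < finrank F W + (u * ε + μ) := by
    intro W i hW
    obtain ⟨W₁, h1, h2⟩ := exists_enlarge hx hcov i W (by omega)
    obtain ⟨W₂, h3, h4⟩ := exists_finrank_add_one_eq hx (u * r + v - 1 - finrank F W₁) W₁
      (by omega)
    have h5 := hd.add_card_flat_le (W := W₂) (by omega)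
    omega
  -- The choice of `s` gives `(u + 1) r - s = k - 1`, so rank at most `j r - s` leaves room for `u +
  -- 1 - j` enlargements. The hypothesis `r < 2 * v` is `2 * s ≤ r + 1`.
  obtain ⟨p, hp1, hp2⟩ := exists_card_near_multiple (s := r - v + 1) (μ := μ) (u := u) hx hcov
    (by omega) hμ hru hεu
    (fun W j hj hW => by
      obtain ⟨i, rfl⟩ := Nat.exists_eq_add_of_le hj
      have := hcount W i (by rw [add_mul]; omega)
      rw [add_mul] at this
      omega)
    (fun W j hj hW => by
      obtain ⟨i, hi⟩ := Nat.exists_eq_add_of_le hj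
      have e1 : u * r + r = j * r + i * r := by rw [← add_mul, ← hi]; ring
      have e2 : u * ε + ε = j * ε + i * ε := by rw [← add_mul, ← hi]; ring
      have := hcount W i (by omega)
      omega)
  rw [Fintype.card_fin] at hp1 hp2
  rw [hn] at hp1 hp2
  -- `p > w` would need `m + s > r + ε`, and `p ≤ w` would need `m < μ`.
  rcases Nat.lt_or_ge w p with h | h
  · have := Nat.mul_le_mul_right (r + ε) (Nat.succ_le_of_lt h)
    rw [Nat.succ_mul] at this
    omega
  · have := Nat.mul_le_mul_right (r + ε) h
    omega

end UpperBound

/-! ### Local Vandermonde vectors. -/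

section BlockVectors

open Polynomial

variable {K β ι : Type*} [Field K] [DecidableEq β] [DecidableEq ι] {r : ℕ}

/-- The vector of the index `i`: its entries in the block of `i` are the first `rk` powers of `α i`,
and the others are zero. -/
def blockVec (r : ℕ) (rk : β → ℕ) (blk : ι → β) (α : ι → K) (i : ι) : β → Fin r → K :=
  fun b t => if blk i = b ∧ (t : ℕ) < rk b then α i ^ (t : ℕ) else 0

lemma pow_eq_sum_lagrange {α : ι → K} (hα : Function.Injective α) (L : Finset ι) (y : K) {t : ℕ}
    (ht : t < L.card) : y ^ t = ∑ i ∈ L, (Lagrange.basis L α i).eval y * α i ^ t := by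
  have h := Lagrange.eq_interpolate (s := L) (v := α) (f := (X ^ t : K[X])) hα.injOn
    (by rw [degree_X_pow]; exact_mod_cast ht)
  have h' := congrArg (Polynomial.eval y) h
  rw [Lagrange.interpolate_apply, eval_finsetSum] at h'
  simpa [mul_comm] using h'

lemma blockVec_mem_spanOn {rk : β → ℕ} {blk : ι → β} {α : ι → K} (hα : Function.Injective α)
    {L : Finset ι} {b : β} (hL : ∀ i ∈ L, blk i = b) (hc : rk b ≤ L.card) {l : ι}
    (hl : blk l = b) : blockVec r rk blk α l ∈ spanOn K (blockVec r rk blk α) L := by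
  have : blockVec r rk blk α l =
      ∑ i ∈ L, (Lagrange.basis L α i).eval (α l) • blockVec r rk blk α i := by
    funext b' t
    rw [Finset.sum_apply, Finset.sum_apply]
    simp only [Pi.smul_apply, blockVec, smul_eq_mul]
    by_cases h : b = b' ∧ (t : ℕ) < rk b'
    · obtain ⟨rfl, ht⟩ := h
      rw [if_pos ⟨hl, ht⟩, pow_eq_sum_lagrange hα L (α l) (ht.trans_le hc)]
      exact sum_congr rfl fun i hi => by rw [if_pos ⟨hL i hi, ht⟩]
    · rw [if_neg (by rwa [hl])]
      exact (sum_eq_zero fun i hi => by rw [if_neg (by rwa [hL i hi]), mul_zero]).symm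
  rw [this]
  exact sum_mem fun i hi => smul_mem _ _ (mem_spanOn hi)

/-- Within a block, pairing a relation with the Lagrange basis polynomial of `j`, whose degree is
below the block rank, isolates the coefficient at `j`. -/
lemma linearIndepOn_blockVec {rk : β → ℕ} {blk : ι → β} {α : ι → K}
    (hα : Function.Injective α) (hrk : ∀ b, rk b ≤ r) {T : Finset ι}
    (hT : ∀ b, (T.filter fun i => blk i = b).card ≤ rk b) :
    LinearIndepOn K (blockVec r rk blk α) (T : Set ι) := by
  rw [linearIndepOn_finset_iff]
  intro f hf j hj
  set B := T.filter fun i => blk i = blk j with hB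
  have hjB : j ∈ B := by simp [hB, hj]
  have hpow : ∀ t < rk (blk j), ∑ i ∈ B, f i * α i ^ t = 0 := by
    intro t ht
    have h := congrFun (congrFun hf (blk j)) ⟨t, ht.trans_le (hrk _)⟩
    rw [Finset.sum_apply, Finset.sum_apply] at h
    simp only [Pi.smul_apply, blockVec, smul_eq_mul, Pi.zero_apply] at h
    rw [hB, sum_filter]
    refine Eq.trans (sum_congr rfl fun i _ => ?_) h
    by_cases hi : blk i = blk j <;> simp [hi, ht]
  have hdeg : (Lagrange.basis B α j).natDegree < rk (blk j) := by
    rw [Lagrange.natDegree_basis hα.injOn hjB]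
    have : B.card ≤ rk (blk j) := hT (blk j)
    have := card_pos.2 ⟨j, hjB⟩
    omega
  have h0 : ∑ i ∈ B, f i * (Lagrange.basis B α j).eval (α i) = 0 := by
    simp only [eval_eq_sum_range' hdeg, mul_sum]
    rw [sum_comm]
    refine sum_eq_zero fun t ht => ?_
    rw [← mul_zero ((Lagrange.basis B α j).coeff t), ← hpow t (mem_range.1 ht), mul_sum]
    exact sum_congr rfl fun i _ => by ring
  rw [sum_eq_single_of_mem j hjB fun i hi hij => by
    rw [Lagrange.eval_basis_of_ne hij.symm hi, mul_zero],
    Lagrange.eval_basis_self hα.injOn hjB, mul_one] at h0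
  exact h0

/-- Bounding the part of a set in each block. -/
lemma exists_subset_card_block [Fintype β] (blk : ι → β) (rk : β → ℕ)
    (T : Finset ι) :
    ∃ T' ⊆ T, (∀ b, (T'.filter fun i => blk i = b).card ≤ rk b) ∧
      T'.card = ∑ b, min (T.filter fun i => blk i = b).card (rk b) := by
  choose P hP hPc using fun b => exists_subset_card_eq
    (min_le_left (T.filter fun i => blk i = b).card (rk b))
  have hblk : ∀ b, ∀ i ∈ P b, blk i = b := fun b i hi => (mem_filter.1 (hP b hi)).2
  refine ⟨univ.biUnion P, biUnion_subset.2 fun b _ => (hP b).trans (filter_subset _ _), ?_, ?_⟩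
  · intro b
    have : ((univ.biUnion P).filter fun i => blk i = b) ⊆ P b := by
      intro i hi
      simp only [mem_filter, mem_biUnion, mem_univ, true_and] at hi
      obtain ⟨⟨b', hi'⟩, rfl⟩ := hi
      rwa [hblk _ _ hi']
    exact (card_le_card this).trans ((hPc b).trans_le (min_le_right _ _))
  · rw [card_biUnion]
    · exact sum_congr rfl fun b _ => hPc b
    · intro b _ b' _ hbb'
      exact disjoint_left.2 fun i hi hi' => hbb' ((hblk _ _ hi).symm.trans (hblk _ _ hi'))

end BlockVectors

lemma exists_blocks {β : Type*} [Fintype β] [DecidableEq β] {n : ℕ} (c : β → ℕ)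
    (hc : ∑ b, c b = n) :
    ∃ blk : Fin n → β, ∀ b, (univ.filter fun i => blk i = b).card = c b := by
  let e : (Σ b, Fin (c b)) ≃ Fin n := Fintype.equivFinOfCardEq (by simp [hc])
  refine ⟨fun i => (e.symm i).1, fun b => ?_⟩
  have : (univ.filter fun i => (e.symm i).1 = b) =
      (univ : Finset (Fin (c b))).image fun j => e ⟨b, j⟩ := by
    ext i
    simp only [mem_filter, mem_univ, true_and, mem_image]
    constructor
    · rintro rfl
      exact ⟨(e.symm i).2, by simp⟩
    · rintro ⟨j, rfl⟩
      simp
  rw [this, card_image_of_injective _ fun j j' h => by simpa using h, card_univ, Fintype.card_fin]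

/-- Only blocks with more than `r` chosen points lose rank, at most `ε` each. Either `u + 1` such
blocks give enough rank, or the total loss is at most `u ε`. -/
lemma le_sum_min_or {β : Type*} [Fintype β] (f : β → ℕ) {r ε : ℕ} (hf : ∀ b, f b ≤ r + ε)
    (u : ℕ) : (u + 1) * r ≤ ∑ b, min (f b) r ∨ ∑ b, f b ≤ ∑ b, min (f b) r + u * ε := by
  classical
  by_cases h : u + 1 ≤ (univ.filter fun b => r < f b).card
  · left
    calc (u + 1) * r ≤ (univ.filter fun b => r < f b).card * r := Nat.mul_le_mul_right _ h
      _ = ∑ b ∈ univ.filter fun b => r < f b, min (f b) r := by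
        rw [sum_congr rfl fun b hb => min_eq_right (mem_filter.1 hb).2.le, sum_const, smul_eq_mul]
      _ ≤ _ := sum_le_sum_of_subset (filter_subset _ _)
  · right
    calc ∑ b, f b ≤ ∑ b, (min (f b) r + if r < f b then ε else 0) := by
          refine sum_le_sum fun b _ => ?_
          have := hf b
          split_ifs <;> omega
      _ = ∑ b, min (f b) r + (univ.filter fun b => r < f b).card * ε := by
          rw [sum_add_distrib, ← sum_filter, sum_const, smul_eq_mul]
      _ ≤ _ := by
          have : (univ.filter fun b => r < f b).card ≤ u := by omega
          gcongr

/-! ### Evaluation codes of linearized polynomials. -/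

section Linearized

open Polynomial

variable {p : ℕ} [Fact p.Prime] {E : Type*} [Field E] [Algebra (ZMod p) E] {n k : ℕ}

/-- The evaluation of the linearized polynomial with coefficients `a`. -/
def linearizedEval (p : ℕ) [Fact p.Prime] {E : Type*} [Field E] [Algebra (ZMod p) E] {k : ℕ}
    (a : Fin k → E) : E →ₗ[ZMod p] E :=
  AddMonoidHom.toZModLinearMap p
    { toFun := fun y => ∑ t, a t * y ^ p ^ (t : ℕ)
      map_zero' := by
        have := (Fact.out : p.Prime).ne_zero
        simp [this]
      map_add' := fun y z => by
        have : CharP E p := charP_of_injective_algebraMap (algebraMap (ZMod p) E).injective p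
        simp only [add_pow_char_pow, mul_add, sum_add_distrib] }

lemma linearizedEval_apply (a : Fin k → E) (y : E) :
    linearizedEval p a y = ∑ t, a t * y ^ p ^ (t : ℕ) := rfl

/-- The kernel consists of roots of a nonzero polynomial of degree at most `p ^ (k - 1)`. -/
lemma finrank_ker_linearizedEval_lt [Finite E] {a : Fin k → E} (ha : a ≠ 0) :
    finrank (ZMod p) (LinearMap.ker (linearizedEval p a)) < k := by
  have hp : p.Prime := Fact.out
  obtain ⟨t₀, ht₀⟩ := Function.ne_iff.1 ha
  have hk : 0 < k := t₀.pos
  set P : E[X] := ∑ t, C (a t) * X ^ p ^ (t : ℕ) with hP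
  have hP0 : P ≠ 0 := by
    intro h
    apply ht₀
    have hc := congrArg (fun Q => Polynomial.coeff Q (p ^ (t₀ : ℕ))) h
    simp only [hP, finsetSum_coeff, coeff_C_mul, coeff_X_pow, coeff_zero,
      (Nat.pow_right_injective hp.two_le).eq_iff, Fin.val_inj] at hc
    simpa using hc
  have hdeg : P.natDegree ≤ p ^ (k - 1) := by
    refine natDegree_sum_le_of_forall_le _ _ fun t _ => (natDegree_C_mul_X_pow_le _ _).trans ?_
    exact Nat.pow_le_pow_right hp.pos (by omega)
  have hroots : Nat.card (LinearMap.ker (linearizedEval p a)) ≤ p ^ (k - 1) := by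
    classical
    have hsub : ((LinearMap.ker (linearizedEval p a) : Submodule (ZMod p) E) : Set E) ⊆
        P.roots.toFinset := by
      intro y hy
      simp only [SetLike.mem_coe, LinearMap.mem_ker, linearizedEval_apply] at hy
      rw [mem_coe, Multiset.mem_toFinset, mem_roots hP0, IsRoot.def, hP, eval_finsetSum]
      simpa using hy
    calc Nat.card (LinearMap.ker (linearizedEval p a)) ≤ Nat.card (P.roots.toFinset : Set E) :=
          Nat.card_mono (Finset.finite_toSet _) hsub
      _ = P.roots.toFinset.card := by rw [Nat.card_coe_set_eq, Set.ncard_coe_finset]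
      _ ≤ P.roots.card := Multiset.toFinset_card_le _
      _ ≤ P.natDegree := card_roots' P
      _ ≤ _ := hdeg
  rw [Module.natCard_eq_pow_finrank (K := ZMod p), Nat.card_zmod] at hroots
  have := (Nat.pow_le_pow_iff_right hp.one_lt).1 hroots
  omega

/-- The encoder that evaluates linearized polynomials at the points `y i`. -/
def linearizedEncoder (p : ℕ) {E : Type*} [Field E] {n : ℕ} (k : ℕ) (y : Fin n → E) :
    (Fin k → E) →ₗ[E] (Fin n → E) where
  toFun a i := ∑ t, a t * y i ^ p ^ (t : ℕ)
  map_add' a b := by funext i; simp [add_mul, sum_add_distrib]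
  map_smul' c a := by funext i; simp [mul_sum, mul_assoc]

lemma linearizedEncoder_apply (y : Fin n → E) (a : Fin k → E) (i : Fin n) :
    linearizedEncoder p k y a i = linearizedEval p a (y i) := rfl

/-- Linearized polynomials are `ZMod p`-linear maps, so relations among the points become relations
among code symbols. -/
lemma isRepairSet_range_linearizedEncoder {y : Fin n → E} {r ε : ℕ} {S : Finset (Fin n)}
    (hS : IsVecRepair (ZMod p) y (r + ε) ε S) :
    IsRepairSet (LinearMap.range (linearizedEncoder p k y)) r (ε + 1) S := by
  refine ⟨hS.1, fun l hl L hL hLc => ?_⟩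
  have hmem := hS.2 L (hL.trans (erase_subset _ _)) hLc (mem_spanOn hl)
  obtain ⟨c, hc⟩ := (mem_span_image_finset_iff_exists_fun _).1 hmem
  refine ⟨fun i => if h : i ∈ L then algebraMap (ZMod p) E (c ⟨i, h⟩) else 0, ?_⟩
  rintro _ ⟨a, rfl⟩
  simp only [linearizedEncoder_apply]
  rw [← hc, map_sum, ← sum_coe_sort L]
  exact sum_congr rfl fun i _ => by rw [map_smul, Algebra.smul_def, dif_pos i.2]

/-- A codeword that vanishes on a set whose points span dimension `k` is zero. -/
lemma eq_zero_of_linearizedEncoder_eq_zero [Finite E] {y : Fin n → E} {a : Fin k → E}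
    {T : Finset (Fin n)} (hT : k ≤ finrank (ZMod p) (spanOn (ZMod p) y T))
    (ha : ∀ i ∈ T, linearizedEncoder p k y a i = 0) : a = 0 := by
  by_contra h
  have h1 := finrank_ker_linearizedEval_lt (p := p) h
  have h2 : spanOn (ZMod p) y T ≤ LinearMap.ker (linearizedEval p a) :=
    spanOn_le.2 fun i hi => ha i hi
  have h3 := Submodule.finrank_mono h2
  omega

end Linearized

/-! ### The optimal code and the value of `d_max`. -/

/-- A code with locality of length `w * (r + ε) + m`, dimension `u * r + v` and large distance. -/
theorem exists_code_hasLocality {n r ε u v w m : ℕ} (hr : 0 < r) (hvr : v ≤ r)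
    (hn : n = w * (r + ε) + m) (hm : m ≤ r + ε)
    (hkn : u * r + v + u * ε + min m ε ≤ n) :
    ∃ (F : Type) (_ : Field F) (_ : Fintype F) (_ : DecidableEq F)
      (C : Submodule F (Fin n → F)), finrank F C = u * r + v ∧ HasLocality C r (ε + 1) ∧
        ∀ c ∈ C, c ≠ 0 → n + 1 ≤ hammingNorm c + (u * r + v + u * ε + min m ε) := by
  classical
  -- `p > n` makes the `n` Vandermonde nodes distinct; the field degree `(w + 1) * r` counts the
  -- entries of the block vectors.
  obtain ⟨p, hpn, hp⟩ := Nat.exists_infinite_primes (n + 1)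
  have : Fact p.Prime := ⟨hp⟩
  let E := GaloisField p ((w + 1) * r)
  have hfin : Finite E := inferInstanceAs (Finite (GaloisField p ((w + 1) * r)))
  -- The subtraction truncates: if `m ≤ ε`, the points of the short block are zero and all codewords
  -- vanish there. In every case this block loses at most `min m ε` in rank.
  let rk : Option (Fin w) → ℕ := fun b => b.elim (m - ε) fun _ => r
  have hrk : ∀ b, rk b ≤ r := by rintro (_ | b) <;> simp [rk]; omega
  let c : Option (Fin w) → ℕ := fun b => b.elim m fun _ => r + ε
  have hcrk : ∀ b, c b - ε = rk b := by rintro (_ | b) <;> simp [c, rk]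
  obtain ⟨blk, hblk⟩ := exists_blocks (n := n) c (by simp [c, hn, add_comm])
  let α : Fin n → ZMod p := fun i => ((i : ℕ) : ZMod p)
  have hα : Function.Injective α := by
    intro i j hij
    have := (ZMod.natCast_eq_natCast_iff' _ _ _).1 hij
    rw [Nat.mod_eq_of_lt (by omega), Nat.mod_eq_of_lt (by omega)] at this
    exact Fin.ext this
  let φ : (Option (Fin w) → Fin r → ZMod p) ≃ₗ[ZMod p] E := LinearEquiv.ofFinrankEq _ _ (by
    rw [GaloisField.finrank p (by positivity)]
    simp [Module.finrank_pi_fintype])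
  let y : Fin n → E := fun i => φ (blockVec r rk blk α i)
  have hspan : ∀ T : Finset (Fin n), spanOn (ZMod p) y T =
      (spanOn (ZMod p) (blockVec r rk blk α) T).map (φ : _ →ₗ[ZMod p] E) := by
    intro T
    rw [spanOn, spanOn, Submodule.map_span, ← Set.image_comp]
    rfl
  have hbig : ∀ T : Finset (Fin n), u * r + v + u * ε + min m ε ≤ T.card →
      u * r + v ≤ finrank (ZMod p) (spanOn (ZMod p) y T) := by
    intro T hT
    obtain ⟨T', hT', hT'b, hT'c⟩ := exists_subset_card_block blk rk T
    have hli := linearIndepOn_blockVec hα hrk hT'b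
    have h1 : finrank (ZMod p) (spanOn (ZMod p) (blockVec r rk blk α) T') = T'.card := by
      have := finrank_span_eq_card hli
      rw [← Set.image_eq_range, ← Set.toFinset_card, toFinset_coe] at this
      exact this
    have h2 : spanOn (ZMod p) (blockVec r rk blk α) T' ≤
        spanOn (ZMod p) (blockVec r rk blk α) T :=
      spanOn_le.2 fun i hi => mem_spanOn (hT' hi)
    have h3 := Submodule.finrank_mono h2
    rw [hspan, LinearEquiv.finrank_map_eq]
    refine le_trans ?_ (h1 ▸ h3)
    have hsum : T.card = ∑ b, (T.filter fun i => blk i = b).card :=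
      card_eq_sum_card_fiberwise fun i _ => mem_univ (blk i)
    have hle : ∀ b, (T.filter fun i => blk i = b).card ≤ c b := fun b =>
      (card_le_card (filter_subset_filter _ (subset_univ T))).trans (hblk b).le
    rw [hT'c, Fintype.sum_option]
    rw [Fintype.sum_option] at hsum
    have hnone := hle none
    simp only [rk, c, Option.elim_none, Option.elim_some] at hnone ⊢
    rcases le_sum_min_or (fun b : Fin w => (T.filter fun i => blk i = some b).card)
      (fun b => hle (some b)) u with h | h
    · rw [add_mul, one_mul] at h
      omega
    · omega
  have hzero : ∀ a : Fin (u * r + v) → E, linearizedEncoder p _ y a = 0 → a = 0 := by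
    intro a ha
    refine eq_zero_of_linearizedEncoder_eq_zero (hbig univ (by simpa using hkn)) fun i _ => ?_
    rw [ha]; rfl
  refine ⟨E, inferInstance, Fintype.ofFinite E, Classical.decEq E,
    LinearMap.range (linearizedEncoder p (u * r + v) y), ?_, ?_, ?_⟩
  · rw [LinearMap.finrank_range_of_inj (LinearMap.ker_eq_bot.1 (LinearMap.ker_eq_bot'.2 hzero))]
    simp
  · intro i
    refine ⟨univ.filter fun j => blk j = blk i, by simp, isRepairSet_range_linearizedEncoder ?_⟩
    refine ⟨?_, fun L hL hLc => ?_⟩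
    · rw [hblk]
      rcases blk i with (_ | b)
      · exact hm
      · exact le_rfl
    · rw [hspan, hspan]
      refine Submodule.map_mono (spanOn_le.2 fun l hl => ?_)
      rw [hblk, hcrk] at hLc
      exact blockVec_mem_spanOn hα (fun j hj => (mem_filter.1 (hL hj)).2) hLc.ge
        (mem_filter.1 hl).2
  · rintro _ ⟨a, rfl⟩ ha
    by_contra hlt
    push Not at hlt
    refine ha ?_
    have hsplit : (univ.filter fun i => linearizedEncoder p (u * r + v) y a i = 0).card +
        hammingNorm (linearizedEncoder p (u * r + v) y a) = n := by
      have := card_filter_add_card_filter_not (s := (univ : Finset (Fin n)))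
        (fun i => linearizedEncoder p (u * r + v) y a i = 0)
      rw [card_univ, Fintype.card_fin] at this
      exact this
    have ha0 : a = 0 := eq_zero_of_linearizedEncoder_eq_zero
      (hbig (univ.filter fun i => linearizedEncoder p (u * r + v) y a i = 0) (by omega))
      fun i hi => (mem_filter.1 hi).2
    rw [ha0, map_zero]

/-- The largest distance in both residue ranges of the length modulo `r + ε`. -/
theorem isDMax_of_lt {n r ε u v w m : ℕ} (hn : n = w * (r + ε) + m) (hm : m < v + ε)
    (hv : 0 < v) (hvr : v < r) (hrv : r < 2 * v) (hru : r ≤ u) (hεu : ε ≤ u)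
    (hkn : u * r + v + u * ε + min m ε ≤ n) :
    IsDMax n (u * r + v) r (ε + 1) ((n : ℤ) + 1 - ((u * r + v + u * ε + min m ε : ℕ) : ℤ)) := by
  have hupper : ∀ (F : Type) (_ : Field F) (_ : DecidableEq F) (C : Submodule F (Fin n → F)) (d : ℕ),
      finrank F C = u * r + v → HasLocality C r (ε + 1) → IsMinDist C d →
      d + (u * r + v + u * ε + min m ε) ≤ n + 1 := by
    intro F _ _ C d hk hC hd
    have := hd.le_of_hasLocality hC hk hv hrv hvr.le hru hεu hn (min_le_right m ε)
      (min_le_left m ε) hm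
    omega
  constructor
  · obtain ⟨F, _, _, _, C, hk, hC, hw⟩ := exists_code_hasLocality (u := u) (v := v) (by omega)
      hvr.le hn (by omega) hkn
    have hne : C ≠ ⊥ := by
      rintro rfl
      rw [finrank_bot] at hk
      omega
    obtain ⟨c, hc, hc0⟩ := Submodule.exists_mem_ne_zero_of_ne_bot hne
    have hnonempty : {t : ℕ | ∃ x ∈ C, ∃ y ∈ C, x ≠ y ∧ hammingDist x y = t}.Nonempty :=
      ⟨_, c, hc, 0, zero_mem _, hc0, rfl⟩
    have hd : IsMinDist C (sInf {t : ℕ | ∃ x ∈ C, ∃ y ∈ C, x ≠ y ∧ hammingDist x y = t}) :=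
      ⟨Nat.sInf_mem hnonempty, fun t ht => Nat.sInf_le ht⟩
    refine ⟨F, ‹_›, ‹_›, ‹_›, C, _, hk, hC, hd, ?_⟩
    -- The upper bound, applied to the constructed code, turns its lower bound on the distance into
    -- an equality.
    have h1 := hupper F _ _ C _ hk hC hd
    obtain ⟨x, hx, y, hy, hxy, ht⟩ := hd.1
    have h2 := hw (-x + y) (add_mem (neg_mem hx) hy) fun h => hxy (neg_add_eq_zero.1 h)
    rw [← hammingDist_eq_hammingNorm, ht] at h2
    omega
  · rintro z ⟨F, _, _, _, C, d, hk, hC, hd, rfl⟩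
    have := hupper F _ _ C d hk hC hd
    omega

end LRC

theorem theorem2 (n k r δ w m u v : ℕ) (hδ : 2 ≤ δ)
    (hn : n = w * (r + δ - 1) + m) (hm : m < r + δ - 1)
    (hk : k = u * r + v) (hv : 0 < v) (hvr : v ≤ r)
    (hm0 : 0 < m) (hvr' : v < r)
    (hr : 0 < r) (hrk : r < k)
    (hkn : (k : ℤ) ≤ (n : ℤ) - ⌈(k : ℚ) / (r : ℚ)⌉ * ((δ : ℤ) - 1))
    (hvm : max ((m : ℤ) - (δ : ℤ) + 1) ⌊(r : ℚ) / 2⌋ < (v : ℤ)) :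
    (δ ≤ m →
      max (2 * ((r : ℤ) + (δ : ℤ) - 1 - (m : ℤ))) ((r : ℤ) + (δ : ℤ) - 1) ≤ (u : ℤ) →
      LRC.IsDMax n k r δ
        ((n : ℤ) - (k : ℤ) + 1 - ⌈(k : ℚ) / (r : ℚ)⌉ * ((δ : ℤ) - 1))) ∧
    ((m : ℤ) ≤ (δ : ℤ) - 1 →
      2 * (r : ℤ) + (δ : ℤ) - 1 ≤ (u : ℤ) →
      LRC.IsDMax n k r δ
        ((n : ℤ) - (k : ℤ) + 1 - ⌈(k : ℚ) / (r : ℚ)⌉ * ((δ : ℤ) - 1)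
          + ((δ : ℤ) - 1 - (m : ℤ)))) := by
  obtain ⟨ε, rfl⟩ : ∃ ε, δ = ε + 1 := ⟨δ - 1, by omega⟩
  have hceil : ⌈(k : ℚ) / (r : ℚ)⌉ = (u : ℤ) + 1 := by
    have hrq : (0 : ℚ) < r := by exact_mod_cast hr
    have hvq : (0 : ℚ) < v := by exact_mod_cast hv
    have hvrq : (v : ℚ) ≤ r := by exact_mod_cast hvr
    rw [Int.ceil_eq_iff, lt_div_iff₀ hrq, div_le_iff₀ hrq, hk]
    push_cast
    constructor <;> nlinarith
  rw [hceil] at hkn ⊢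
  obtain ⟨hvm1, hvm2⟩ := max_lt_iff.1 hvm
  have hrv : r < 2 * v := by
    rw [Int.floor_lt, div_lt_iff₀ (by norm_num)] at hvm2
    have : r < v * 2 := by exact_mod_cast hvm2
    omega
  have hε : ((u : ℤ) + 1) * (((ε + 1 : ℕ) : ℤ) - 1) = ((u * ε : ℕ) : ℤ) + ε := by
    push_cast; ring
  rw [hε] at hkn ⊢
  have hn' : n = w * (r + ε) + m := hn
  subst hk
  -- Both cases imply `r ≤ u` and `ε ≤ u`; they differ only in the value of `min m ε`.
  have hmain : r ≤ u → ε ≤ u → _ := fun h1 h2 =>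
    LRC.isDMax_of_lt (u := u) hn' (by omega) hv hvr' hrv h1 h2 (by omega)
  constructor
  · intro hmδ hu
    have hu' := (le_max_right _ _).trans hu
    convert hmain (by omega) (by omega) using 1
    omega
  · intro hmδ hu
    convert hmain (by omega) (by omega) using 1
    omega
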